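/- Let $m\ge 1$ and $n\ge 0$ be integers. An \emph{$m$-parking function of size $n$} is a function $f:\{1,\dots,n\}\to\{1,\dots,1+m(n-1)\}$ whose nondecreasing rearrangement $g_1\le g_2\le\cdots\le g_n$ satisfies $g_i\le 1+m(i-1)$ for all $1\le i\le n$; it is identified with the word $f(1)f(2)\cdots f(n)$. (For $n=0$ there is exactly one, the empty word.) The \emph{metasylvester congruence} on words over a totally ordered alphabet is the equivalence relation generated by $$u\,ac\,v\,a\,w\equiv u\,ca\,v\,a\,w\quad(a<c),\qquad u\,b\,v\,ac\,v'\,b\,w\equiv u\,b\,v\,ca\,v'\,b\,w\quad(a<b<c),$$ where $a,b,c$ are letters and $u,v,v',w$ are arbitrary, possibly empty, words. Let $\mathcal C^{(m)}_n$ be the set of $m$-Catalan paths of length $(m+1)n$, that is, lattice paths that start on the $x$-axis, consist of $n$ up-steps of size $m$ and $mn$ down-steps of size $1$, and never go below the $x$-axis. For $C\in\mathcal C^{(m)}_n$ let $w(C)=(w(C)_1,\dots,w(C)_{|w(C)|})$ be the sequence recording, in order, the number of up-steps in each maximal block of consecutive up-steps of $C$. Then the number of metasylvester classes of $m$-parking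 functions of size $n$ is $$\sum_{C\in\mathcal C^{(m)}_n}\ \prod_{i=2}^{|w(C)|}\Bigl(1+\sum_{j=i}^{|w(C)|}w(C)_j\Bigr),$$ where an empty product equals $1$. -/

import Mathlib

/-- A function `f : [n] → {1, 2, …}` is an `m`-parking function of size `n` if its values lie in
`{1, …, 1 + m (n - 1)}` and its nondecreasing rearrangement `g = f ∘ Tuple.sort f` satisfies
`g (i) ≤ 1 + m (i - 1)` for `i = 1, …, n` (positions are indexed from `0` by `Fin n` below). -/
def IsMParkingFunction (m n : ℕ) (f : Fin n → ℕ) : Prop :=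
  (∀ i, f i ∈ Finset.Icc 1 (1 + m * (n - 1))) ∧ ∀ i : Fin n, f (Tuple.sort f i) ≤ 1 + m * (i : ℕ)

/-- The `m`-parking functions of size `n`. -/
def MParkingFunction (m n : ℕ) : Type :=
  {f : Fin n → ℕ // IsMParkingFunction m n f}

/-- The word `f(1) f(2) ⋯ f(n)` of an `m`-parking function. -/
def MParkingFunction.word {m n : ℕ} (f : MParkingFunction m n) : List ℕ :=
  List.ofFn f.1

/-- The elementary rewritings generating the metasylvester congruence on words over a totally
ordered alphabet:
`… a c … a … ≡ … c a … a …` for `a < c`, and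
`… b … a c … b … ≡ … b … c a … b …` for `a < b < c`,
where the dots stand for arbitrary (possibly empty) words. -/
inductive MetasylvesterStep {α : Type*} [LinearOrder α] : List α → List α → Prop
  | outer (u v w : List α) (a c : α) (hac : a < c) :
      MetasylvesterStep (u ++ [a, c] ++ v ++ [a] ++ w) (u ++ [c, a] ++ v ++ [a] ++ w)
  | inner (u v v' w : List α) (a b c : α) (hab : a < b) (hbc : b < c) :
      MetasylvesterStep (u ++ [b] ++ v ++ [a, c] ++ v' ++ [b] ++ w)
        (u ++ [b] ++ v ++ [c, a] ++ v' ++ [b] ++ w)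

/-- The metasylvester congruence: the equivalence relation generated by `MetasylvesterStep`. -/
def metasylvesterSetoid (α : Type*) [LinearOrder α] : Setoid (List α) :=
  Relation.EqvGen.setoid MetasylvesterStep

/-- The metasylvester congruence on `m`-parking functions of size `n`, seen as words. -/
def mParkingSetoid (m n : ℕ) : Setoid (MParkingFunction m n) :=
  (metasylvesterSetoid ℕ).comap MParkingFunction.word

/-- `m`-Catalan paths of length `(m + 1) n`, as words in up-steps `U` (of size `m`) and down-steps
`D` (of size `1`): there are `n` up-steps and `m n` down-steps, and the path never goes below
the `x`-axis. -/
def IsMCatalanPath (m n : ℕ) (C : List DyckStep) : Prop :=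
  C.count DyckStep.U = n ∧ C.count DyckStep.D = m * n ∧
    ∀ k, (C.take k).count DyckStep.D ≤ m * (C.take k).count DyckStep.U

theorem IsMCatalanPath.length_eq {m n : ℕ} {C : List DyckStep} (h : IsMCatalanPath m n C) :
    C.length = n + m * n := by
  have key : ∀ l : List DyckStep, l.length = l.count DyckStep.U + l.count DyckStep.D := by
    intro l
    induction l with
    | nil => rfl
    | cons s l ih => cases s <;> simp [ih] <;> omega
  rw [key, h.1, h.2.1]

theorem finite_setOf_isMCatalanPath (m n : ℕ) : {C | IsMCatalanPath m n C}.Finite := by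
  have : Finite DyckStep :=
    Finite.of_injective (fun s : DyckStep => decide (s = DyckStep.U)) (by
      intro s t h
      cases s <;> cases t <;> simp_all)
  exact (List.finite_length_eq DyckStep (n + m * n)).subset fun C hC => hC.length_eq

/-- The finite set of `m`-Catalan paths of length `(m + 1) n`. -/
noncomputable def mCatalanPaths (m n : ℕ) : Finset (List DyckStep) :=
  (finite_setOf_isMCatalanPath m n).toFinset

/-- The sequence `w(C)` of the lengths of the maximal blocks of consecutive up-steps of `C`, in
order: cut `C` at its down-steps and keep the nonempty pieces. -/
def upBlocks (C : List DyckStep) : List ℕ :=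
  ((C.splitOn DyckStep.D).map List.length).filter (fun t => t ≠ 0)

/-- The entry `w_j` of a finite sequence `w`, indexed from `1`. -/
def entry (w : List ℕ) (j : ℕ) : ℕ :=
  w.getD (j - 1) 0

/-! Each metasylvester class contains exactly one word avoiding `b c b` with `b < c`. Such a pattern
permits a lexicographically increasing rewriting, so the maximum of the (finite) class avoids it
(`exists_peakAvoiding_equiv`). Uniqueness (`PeakAvoiding.eq_of_equiv`) comes from a class invariant:
for `x < y`, the number of `y` after the last `x`, discarded when some intermediate letter lies on
both sides of that `x`. In an avoiding word the copies of the smallest letter form one block, and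
the invariant fixes its position relative to the other letters.

The same block structure counts avoiding words of given content: a block of a new smallest letter
can be inserted in `1 + |M|` places (`card_peakAvoidingWord_replicate_add`), which yields the
factors of the product. Finally, labelling each up-step by one plus the number of earlier down-steps
matches `m`-Catalan paths with contents of parking functions (`isMCatalanPath_iff`), so the blocks
of up-steps are the letter multiplicities. -/

/-- A word avoids the pattern `b c b` with `b < c`: only smaller letters occur between two equal
letters. -/
def PeakAvoiding {α : Type*} [LinearOrder α] (l : List α) : Prop :=
  ∀ b c : α, b < c → ¬ List.Sublist [b, c, b] l

theorem triple_sublist_of_mem {α : Type*} {b c : α} {s d t : List α} (hs : b ∈ s) (hd : c ∈ d) (ht : b ∈ t) :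
    List.Sublist [b, c, b] (s ++ d ++ t) := by
  have := ((List.singleton_sublist.2 hs).append (List.singleton_sublist.2 hd)).append
    (List.singleton_sublist.2 ht)
  simpa using this

/-! ### Existence of a pattern-avoiding representative. -/

section Congruence

variable {α : Type*} [LinearOrder α]

theorem PeakAvoiding.sublist {l l' : List α} (h : PeakAvoiding l) (hl : List.Sublist l' l) :
    PeakAvoiding l' :=
  fun b c hbc hs => h b c hbc (hs.trans hl)

theorem MetasylvesterStep.perm {l l' : List α} (h : MetasylvesterStep l l') : l.Perm l' := by
  cases h with
  | outer u v w a c _ =>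
    simp only [List.append_assoc]
    exact List.Perm.append_left _ (List.Perm.append_right _ (List.Perm.swap _ _ _))
  | inner u v v' w a b c _ _ =>
    simp only [List.append_assoc]
    exact (List.Perm.append_right _ (List.Perm.swap _ _ _)).append_left _ |>.append_left _
      |>.append_left _

theorem metasylvester_perm {l l' : List α} (h : metasylvesterSetoid α l l') : l.Perm l' := by
  induction h with
  | rel _ _ h => exact h.perm
  | refl => exact List.Perm.refl _
  | symm _ _ _ ih => exact ih.symm
  | trans _ _ _ _ _ ih ih' => exact ih.trans ih'

/-- Split off the first letter exceeding `b`. -/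
theorem exists_first_gt {b c : α} {l : List α} (hbc : b < c) (h : List.Sublist [c, b] l) :
    ∃ y c' z z', b < c' ∧ (∀ x ∈ y, x ≤ b) ∧ l = y ++ c' :: (z ++ b :: z') := by
  induction l with
  | nil => simp at h
  | cons x l ih =>
    by_cases hx : b < x
    · have hb : b ∈ l := by
        cases h with
        | cons _ h => exact h.subset (by simp)
        | cons_cons _ h => exact h.subset (by simp)
      obtain ⟨z, z', rfl⟩ := List.append_of_mem hb
      exact ⟨[], x, z, z', hx, by simp, rfl⟩
    · have h' : List.Sublist [c, b] l := by
        cases h with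
        | cons _ h => exact h
        | cons_cons _ h => exact absurd hbc hx
      obtain ⟨y, c', z, z', hc', hy, rfl⟩ := ih h'
      exact ⟨x :: y, c', z, z', hc', by simpa using ⟨not_lt.1 hx, hy⟩, rfl⟩

theorem append_swap_lt (u t : List α) {a c : α} (h : a < c) :
    u ++ a :: c :: t < u ++ c :: a :: t := by
  induction u with
  | nil => exact List.Lex.rel h
  | cons x u ih => exact List.Lex.cons ih

/-- A word containing a pattern `b c b` admits a lexicographically increasing rewriting. -/
theorem exists_step_lt {l : List α} (h : ¬ PeakAvoiding l) :
    ∃ l', MetasylvesterStep l l' ∧ l < l' := by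
  simp only [PeakAvoiding, not_forall, not_not] at h
  obtain ⟨b, c, hbc, h⟩ := h
  obtain ⟨p, q, rfl, hp, hq⟩ := List.cons_sublist_iff.1 h
  obtain ⟨u, u', rfl⟩ := List.append_of_mem hp
  have hq' : List.Sublist [c, b] (u' ++ q) := hq.trans (List.sublist_append_right _ _)
  obtain ⟨y, c', z, z', hc', hy, he⟩ := exists_first_gt hbc hq'
  have he' : u ++ b :: u' ++ q = u ++ b :: (y ++ c' :: (z ++ b :: z')) := by
    simp [he]
  rw [he']
  -- Swap `c'` with the letter just before it: either the first `b` itself or the last letter `d ≤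
  -- b` of `y`. The remaining copies of `b` license the move.
  rcases List.eq_nil_or_concat y with rfl | ⟨y', d, rfl⟩
  · refine ⟨u ++ c' :: b :: (z ++ b :: z'), ?_, append_swap_lt _ _ hc'⟩
    simpa using MetasylvesterStep.outer u z z' b c' hc'
  · have hd : d ≤ b := hy d (by simp)
    have key := append_swap_lt (u ++ b :: y') (z ++ b :: z') (hd.trans_lt hc')
    refine ⟨_, ?_, by simpa using key⟩
    rcases hd.eq_or_lt with rfl | hd
    · simpa using MetasylvesterStep.outer (u ++ d :: y') z z' d c' hc'
    · simpa using MetasylvesterStep.inner u y' z z' d b c' hd hc'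

theorem exists_peakAvoiding_equiv (l : List α) :
    ∃ l', metasylvesterSetoid α l l' ∧ PeakAvoiding l' := by
  have hfin : {l' | metasylvesterSetoid α l l'}.Finite :=
    l.permutations.finite_toSet.subset fun l' h =>
      List.mem_permutations.2 (metasylvester_perm h).symm
  obtain ⟨l', hl', hmax⟩ := hfin.exists_maximalFor id _ ⟨l, (metasylvesterSetoid α).refl l⟩
  refine ⟨l', hl', by_contra fun h => ?_⟩
  obtain ⟨l'', hs, hlt⟩ := exists_step_lt h
  exact (hlt.trans_le (hmax ((metasylvesterSetoid α).trans hl' (Relation.EqvGen.rel _ _ hs)) hlt.le)).false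

/-! ### An invariant of the congruence. -/

/-- Transition function of a counter of the letter `y` that is reset by the letter `x`. -/
def resetCount (x y : α) (n : ℕ) (h : α) : ℕ :=
  if h = x then 0 else if h = y then n + 1 else n

/-- The number of letters `y` after the last `x`. -/
def countAfterLast (x y : α) (l : List α) : ℕ :=
  l.foldl (resetCount x y) 0

theorem foldl_resetCount_of_mem {x y : α} {l : List α} (h : x ∈ l) (n n' : ℕ) :
    l.foldl (resetCount x y) n = l.foldl (resetCount x y) n' := by
  induction l generalizing n n' with
  | nil => simp at h
  | cons z l ih =>
    simp only [List.foldl_cons]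
    by_cases hl : x ∈ l
    · exact ih hl _ _
    · have : z = x := by simpa [hl, eq_comm] using h
      simp [resetCount, this]

theorem foldl_resetCount_of_notMem {x y : α} {l : List α} (h : x ∉ l) (n : ℕ) :
    l.foldl (resetCount x y) n = n + l.count y := by
  induction l generalizing n with
  | nil => simp
  | cons z l ih =>
    simp only [List.mem_cons, not_or] at h
    rw [List.foldl_cons, ih h.2, resetCount, if_neg (Ne.symm h.1), List.count_cons]
    by_cases hz : z = y <;> simp [hz]; omega

/-- Only the passage of `y` across the last `x` can change the count; since both pairs are
increasing, this forces `x = a` and `y = c` with no later `x`. -/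
theorem countAfterLast_swap {x y a c : α} (u v : List α) (hxy : x < y) (hac : a < c)
    (h : x ∈ v ∨ ¬ (x = a ∧ y = c)) :
    countAfterLast x y (u ++ a :: c :: v) = countAfterLast x y (u ++ c :: a :: v) := by
  simp only [countAfterLast, List.foldl_append, List.foldl_cons]
  rcases h with h | h
  · exact foldl_resetCount_of_mem h _ _
  · congr 1
    have := hxy.ne
    have := hac.ne
    simp only [resetCount]
    split_ifs <;> grind

theorem countAfterLast_append_replicate {x y : α} {k : ℕ} (s : List α) {t : List α} (hk : k ≠ 0)
    (ht : x ∉ t) : countAfterLast x y (s ++ List.replicate k x ++ t) = t.count y := by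
  obtain ⟨k, rfl⟩ := Nat.exists_eq_succ_of_ne_zero hk
  rw [countAfterLast, List.foldl_append, foldl_resetCount_of_notMem ht, List.foldl_append,
    List.replicate_succ', List.foldl_append]
  simp [resetCount]

theorem countAfterLast_filter {x y a : α} (l : List α) (hx : x ≠ a) (hy : y ≠ a) :
    countAfterLast x y (l.filter (· ≠ a)) = countAfterLast x y l := by
  rw [countAfterLast, List.foldl_filter, countAfterLast]
  congr 1
  funext n h
  by_cases ha : h = a
  · subst ha; simp [resetCount, hx.symm, hy.symm]
  · simp [ha]

/-- Some letter strictly between `x` and `y` occurs both before and after the last `x`. -/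
def Straddled (x y : α) (l : List α) : Prop :=
  ∃ b, x < b ∧ b < y ∧ 0 < countAfterLast x b l ∧ countAfterLast x b l < l.count b

open Classical in
/-- The number of letters `y` after the last `x`, forgotten when `x` and `y` can be exchanged by
means of a letter between them. -/
noncomputable def metasylvesterInvariant (x y : α) (l : List α) : Option ℕ :=
  if Straddled x y l then none else some (countAfterLast x y l)

theorem countAfterLast_pos_of_mem {x b : α} (u : List α) {v w : List α}
    (hx : x ∉ w) (hb : b ∈ w) : 0 < countAfterLast x b (u ++ v ++ w) := by
  rw [countAfterLast, List.foldl_append, foldl_resetCount_of_notMem hx]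
  have := List.count_pos_iff.2 hb
  omega

theorem countAfterLast_lt_count {x b : α} {u : List α} (v w : List α) (hxb : x ≠ b)
    (hb : b ∈ u) : countAfterLast x b (u ++ x :: (v ++ w)) < (u ++ x :: (v ++ w)).count b := by
  have key : ∀ (l : List α) n, l.foldl (resetCount x b) n ≤ n + l.count b := by
    intro l
    induction l with
    | nil => simp
    | cons z l ih =>
      intro n
      refine (ih _).trans ?_
      rw [List.count_cons, resetCount]
      split_ifs <;> simp_all; omega
  have h := key (v ++ w) 0
  have := List.count_pos_iff.2 hb
  rw [countAfterLast, List.foldl_append, List.foldl_cons, List.count_append,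
    List.count_cons_of_ne hxb]
  simp only [resetCount, if_true] at h ⊢
  omega

theorem metasylvesterInvariant_congr {x y : α} {l l' : List α} (hp : l.Perm l')
    (h : ∀ b, x < b → b ≤ y → countAfterLast x b l = countAfterLast x b l') (hxy : x < y) :
    metasylvesterInvariant x y l = metasylvesterInvariant x y l' := by
  have : Straddled x y l ↔ Straddled x y l' := by
    refine exists_congr fun b => and_congr_right fun hb => and_congr_right fun hb' => ?_
    rw [h b hb hb'.le, hp.count_eq]
  rw [metasylvesterInvariant, metasylvesterInvariant, h y hxy le_rfl]
  by_cases hs : Straddled x y l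
  · rw [if_pos hs, if_pos (this.1 hs)]
  · rw [if_neg hs, if_neg (mt this.2 hs)]

/-- In an outer step the exchanged `a` is not the last one, so no count moves. In an inner step a
count can move only for `x = a` and the letter `c`; this matters only if `c ≤ y`, and then the
witness `b` straddles the last `a` in both words, making both invariants `none`. -/
theorem MetasylvesterStep.invariant_eq {x y : α} {l l' : List α} (h : MetasylvesterStep l l')
    (hxy : x < y) : metasylvesterInvariant x y l = metasylvesterInvariant x y l' := by
  have hp := h.perm
  cases h with
  | outer u v w a c hac =>
    refine metasylvesterInvariant_congr hp (fun z hxz _ => ?_) hxy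
    have := countAfterLast_swap u (v ++ a :: w) hxz hac
      (by by_cases h : x = a <;> simp [h])
    simpa using this
  | inner u v v' w a b c hab hbc =>
    have key (z : α) (hxz : x < z)
        (h : x ∈ v' ++ b :: w ∨ ¬ (x = a ∧ z = c)) :=
      countAfterLast_swap (u ++ b :: v) (v' ++ b :: w) hxz (hab.trans hbc) h
    have hl : u ++ [b] ++ v ++ [a, c] ++ v' ++ [b] ++ w =
      (u ++ b :: v) ++ a :: c :: (v' ++ b :: w) := by simp
    have hl' : u ++ [b] ++ v ++ [c, a] ++ v' ++ [b] ++ w =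
      (u ++ b :: v) ++ c :: a :: (v' ++ b :: w) := by simp
    rw [hl, hl'] at hp ⊢
    by_cases hx : x ∈ v' ++ b :: w ∨ x ≠ a
    · exact metasylvesterInvariant_congr hp (fun z hxz _ => key z hxz (by tauto)) hxy
    push Not at hx
    obtain ⟨hx, rfl⟩ := hx
    by_cases hy : y < c
    · exact metasylvesterInvariant_congr hp
        (fun z hxz hzy => key z hxz (Or.inr fun h => (h.2 ▸ hzy.trans_lt hy).false)) hxy
    have hby : b < y := hbc.trans_le (not_lt.1 hy)
    have hb := key b hab (Or.inr fun h => hbc.ne h.2)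
    have h1 : 0 < countAfterLast x b (u ++ b :: v ++ c :: x :: (v' ++ b :: w)) := by
      have := countAfterLast_pos_of_mem (u ++ b :: v) (b := b) (v := [c, x]) hx (by simp)
      simpa using this
    have h2 : countAfterLast x b (u ++ b :: v ++ x :: c :: (v' ++ b :: w)) <
        (u ++ b :: v ++ x :: c :: (v' ++ b :: w)).count b := by
      have := countAfterLast_lt_count (u := u ++ b :: v) [c] (v' ++ b :: w) hab.ne (by simp)
      simpa using this
    have s1 : Straddled x y (u ++ b :: v ++ x :: c :: (v' ++ b :: w)) :=
      ⟨b, hab, hby, hb ▸ h1, h2⟩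
    have s2 : Straddled x y (u ++ b :: v ++ c :: x :: (v' ++ b :: w)) :=
      ⟨b, hab, hby, h1, hb ▸ hp.count_eq b ▸ h2⟩
    rw [metasylvesterInvariant, metasylvesterInvariant, if_pos s1, if_pos s2]

theorem metasylvesterInvariant_eq {x y : α} {l l' : List α} (h : metasylvesterSetoid α l l')
    (hxy : x < y) : metasylvesterInvariant x y l = metasylvesterInvariant x y l' := by
  induction h with
  | rel _ _ h => exact h.invariant_eq hxy
  | refl => rfl
  | symm _ _ _ ih => exact ih.symm
  | trans _ _ _ _ _ ih ih' => exact ih.trans ih'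

/-! ### Uniqueness of the avoiding representative. -/

/-- The copies of the smallest letter of a word avoiding `b c b` are contiguous. -/
theorem PeakAvoiding.exists_block {a : α} {l : List α} (h : PeakAvoiding l) (ha : ∀ x ∈ l, a ≤ x) :
    ∃ s t, a ∉ s ∧ a ∉ t ∧ l = s ++ List.replicate (l.count a) a ++ t := by
  induction l with
  | nil => exact ⟨[], [], by simp⟩
  | cons x l ih =>
    obtain ⟨s, t, hs, ht, he⟩ := ih (h.sublist (List.sublist_cons_self _ _))
      fun x hx => ha x (List.mem_cons_of_mem _ hx)
    by_cases hx : x = a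
    · subst hx
      by_cases hl : x ∈ l
      · have hs0 : s = [] := by
          rcases s with _ | ⟨y, s⟩
          · rfl
          exfalso
          have hxy : x < y := lt_of_le_of_ne (ha y (by rw [he]; simp)) fun h => hs (by simp [h])
          refine h x y hxy ?_
          have hk : l.count x ≠ 0 := (List.count_pos_iff.2 hl).ne'
          rw [he]
          have := triple_sublist_of_mem (b := x) (c := y) (s := [x]) (d := y :: s)
            (t := List.replicate (l.count x) x ++ t) (by simp) (by simp) (by simp [hk])
          simpa using this
        subst hs0
        refine ⟨[], t, by simp, ht, ?_⟩
        rw [List.count_cons_self, List.replicate_succ]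
        simpa using he
      · refine ⟨[], l, by simp, hl, ?_⟩
        simp [List.count_eq_zero_of_not_mem hl]
    · refine ⟨x :: s, t, by simp [hs, Ne.symm hx], ht, ?_⟩
      rw [List.count_cons_of_ne hx]
      simpa using he

theorem filter_ne_append_replicate {a : α} {s t : List α} (k : ℕ) (hs : a ∉ s) (ht : a ∉ t) :
    (s ++ List.replicate k a ++ t).filter (· ≠ a) = s ++ t := by
  have h (l : List α) (hl : a ∉ l) : l.filter (· ≠ a) = l :=
    List.filter_eq_self.2 fun x hx => by simpa using fun h : x = a => hl (h ▸ hx)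
  rw [List.filter_append, List.filter_append, h s hs, h t ht]
  simp

/-- Moving the block of the smallest letter in a word avoiding `b c b` changes the invariant. -/
theorem eq_nil_of_invariant_eq {a : α} {k : ℕ} {s d t : List α} (hk : k ≠ 0)
    (hl : PeakAvoiding (s ++ d ++ t)) (ha : ∀ x ∈ s ++ d ++ t, a < x)
    (h : ∀ y, a < y → metasylvesterInvariant a y (s ++ List.replicate k a ++ (d ++ t)) =
      metasylvesterInvariant a y (s ++ d ++ List.replicate k a ++ t)) : d = [] := by
  by_contra hd
  -- With `c` least in `d`, a letter `b` straddling for the pair `a`, `c` would be absent from `d`,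
  -- hence occur in both `s` and `t`, giving `b c b`. So both invariants are genuine counts,
  -- differing by the number of `c` in `d`.
  obtain ⟨c, hc, hmin⟩ := d.toFinset.exists_min_image id (by simpa using hd)
  simp only [List.mem_toFinset, id] at hc hmin
  have hat : a ∉ t := fun h => (ha a (by simp [h])).false
  have had : a ∉ d := fun h => (ha a (by simp [h])).false
  have hac : a < c := ha c (by simp [hc])
  have r1 (y : α) := countAfterLast_append_replicate (y := y) s hk
    (show a ∉ d ++ t by simp [had, hat])
  have r2 (y : α) := countAfterLast_append_replicate (y := y) (s ++ d) hk hat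
  have hcount (b : α) (hb : a < b) : (List.replicate k a).count b = 0 :=
    List.count_eq_zero.2 fun h => hb.ne (List.eq_of_mem_replicate h).symm
  have hbd {b : α} (hbc : b < c) : b ∉ d := fun h => (hbc.trans_le (hmin b h)).false
  have absurd_of {b : α} (hbc : b < c) (h1 : b ∈ s) (h2 : b ∈ t) : False :=
    hl b c hbc (triple_sublist_of_mem h1 hc h2)
  have n1 : ¬ Straddled a c (s ++ List.replicate k a ++ (d ++ t)) := by
    rintro ⟨b, hab, hbc, h1, h2⟩
    rw [r1] at h1 h2
    have hb0 := List.count_eq_zero_of_not_mem (hbd hbc)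
    simp only [List.count_append, hcount b hab, hb0] at h1 h2
    exact absurd_of hbc (List.count_pos_iff.1 (by omega)) (List.count_pos_iff.1 (by omega))
  have n2 : ¬ Straddled a c (s ++ d ++ List.replicate k a ++ t) := by
    rintro ⟨b, hab, hbc, h1, h2⟩
    rw [r2] at h1 h2
    have hb0 := List.count_eq_zero_of_not_mem (hbd hbc)
    simp only [List.count_append, hcount b hab, hb0] at h1 h2
    exact absurd_of hbc (List.count_pos_iff.1 (by omega)) (List.count_pos_iff.1 (by omega))
  have := h c hac
  rw [metasylvesterInvariant, metasylvesterInvariant, if_neg n1, if_neg n2, r1, r2,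
    List.count_append, Option.some_inj] at this
  have := List.count_pos_iff.2 hc
  omega

theorem metasylvesterInvariant_filter {x y a : α} (l : List α) (hax : a < x) (hxy : x < y) :
    metasylvesterInvariant x y (l.filter (· ≠ a)) = metasylvesterInvariant x y l := by
  have hr (b : α) (hb : x < b) := countAfterLast_filter l hax.ne' (hax.trans hb).ne'
  have : Straddled x y (l.filter (· ≠ a)) ↔ Straddled x y l := by
    refine exists_congr fun b => and_congr_right fun hb => and_congr_right fun hb' => ?_
    rw [hr b hb, List.count_filter (by simpa using (hax.trans hb).ne')]
  rw [metasylvesterInvariant, metasylvesterInvariant, hr y hxy]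
  by_cases hs : Straddled x y l
  · rw [if_pos hs, if_pos (this.2 hs)]
  · rw [if_neg hs, if_neg (mt this.1 hs)]

/-- Induction on the set of letters: deleting the smallest letter preserves the hypotheses, so the
two words can differ only in where its block sits, and a nonempty segment between the two positions
would change the invariant. -/
theorem PeakAvoiding.eq_of_invariant_eq {l l' : List α} (hl : PeakAvoiding l)
    (hl' : PeakAvoiding l') (hp : l.Perm l')
    (h : ∀ x ∈ l, ∀ y, x < y → metasylvesterInvariant x y l = metasylvesterInvariant x y l') :
    l = l' := by
  obtain ⟨S, hS⟩ : ∃ S, l.toFinset = S := ⟨_, rfl⟩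
  induction S using Finset.induction_on_min generalizing l l' with
  | empty =>
    obtain rfl : l = [] := by simpa using hS
    exact hp.nil_eq
  | insert a S ha ih =>
    have hmem (x : α) : x ∈ l ↔ x = a ∨ x ∈ S := by
      rw [← List.mem_toFinset, hS, Finset.mem_insert]
    have hle : ∀ x ∈ l, a ≤ x := fun x hx =>
      ((hmem x).1 hx).elim (fun h => h.ge) fun h => (ha x h).le
    have hk : l.count a ≠ 0 := (List.count_pos_iff.2 ((hmem a).2 (Or.inl rfl))).ne'
    have hfilter : l.filter (· ≠ a) = l'.filter (· ≠ a) := by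
      refine ih (hl.sublist List.filter_sublist) (hl'.sublist List.filter_sublist) (hp.filter _)
        (fun x hx y hxy => ?_) ?_
      · simp only [List.mem_filter, decide_eq_true_eq] at hx
        have hax : a < x := lt_of_le_of_ne (hle x hx.1) (Ne.symm hx.2)
        rw [metasylvesterInvariant_filter _ hax hxy, metasylvesterInvariant_filter _ hax hxy]
        exact h x hx.1 y hxy
      · ext x
        have : x ∈ S → x ≠ a := fun h => (ha x h).ne'
        simp only [List.mem_toFinset, List.mem_filter, hmem, decide_eq_true_eq]
        tauto
    obtain ⟨s, t, hs, ht, he⟩ := hl.exists_block hle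
    obtain ⟨s', t', hs', ht', he'⟩ := hl'.exists_block fun x hx => hle x (hp.mem_iff.2 hx)
    rw [← hp.count_eq] at he'
    generalize l.count a = k at hk he he'
    have hpos : ∀ x ∈ s ++ t, a < x := fun x hx =>
      lt_of_le_of_ne (hle x (by rw [he]; simp at hx ⊢; tauto)) fun h => by simp_all
    have hav : PeakAvoiding (s ++ t) := by
      rw [← filter_ne_append_replicate k hs ht, ← he]
      exact hl.sublist List.filter_sublist
    have hinv := h a ((hmem a).2 (Or.inl rfl))
    rw [he, he', filter_ne_append_replicate k hs ht, filter_ne_append_replicate k hs' ht']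
      at hfilter
    rw [he, he'] at hinv ⊢
    rcases List.append_eq_append_iff.1 hfilter with ⟨d, rfl, rfl⟩ | ⟨d, rfl, rfl⟩
    · obtain rfl := eq_nil_of_invariant_eq hk (by simpa using hav) (by simpa using hpos) hinv
      simp
    · obtain rfl := eq_nil_of_invariant_eq hk (by simpa using hav) (by simpa using hpos)
        fun y hy => (hinv y hy).symm
      simp

theorem PeakAvoiding.eq_of_equiv {l l' : List α} (hl : PeakAvoiding l) (hl' : PeakAvoiding l')
    (h : metasylvesterSetoid α l l') : l = l' :=
  hl.eq_of_invariant_eq hl' (metasylvester_perm h) fun _ _ _ => metasylvesterInvariant_eq h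

end Congruence

/-! ### Counting avoiding words of given content. -/

section Counting

variable {α : Type*} [LinearOrder α]

/-- The words with a given content avoiding the pattern `b c b` with `b < c`. -/
abbrev PeakAvoidingWord (M : Multiset α) : Type _ :=
  {l : List α // (l : Multiset α) = M ∧ PeakAvoiding l}

instance (M : Multiset α) : Finite (PeakAvoidingWord M) := by
  obtain ⟨l, rfl⟩ := Quot.exists_rep M
  exact (l.permutations.finite_toSet.subset fun l' h =>
    List.mem_permutations.2 (Multiset.coe_eq_coe.1 h.1) :
      {l' : List α | (l' : Multiset α) = (l : Multiset α) ∧ PeakAvoiding l'}.Finite)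

theorem card_peakAvoidingWord_zero : Nat.card (PeakAvoidingWord (0 : Multiset α)) = 1 := by
  rw [Nat.card_eq_one_iff_unique]
  refine ⟨⟨fun a b => Subtype.ext ?_⟩, ⟨[], rfl, fun b c _ h => by simp at h⟩⟩
  rw [(Multiset.coe_eq_zero _).1 a.2.1, (Multiset.coe_eq_zero _).1 b.2.1]

/-- Inserting a block of a new smallest letter creates no pattern `b c b`. -/
theorem PeakAvoiding.insert_block {a : α} {s t : List α} (k : ℕ) (h : PeakAvoiding (s ++ t))
    (ha : ∀ x ∈ s ++ t, a < x) : PeakAvoiding (s ++ List.replicate k a ++ t) := by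
  have has : a ∉ s := fun h => (ha a (by simp [h])).false
  have hat : a ∉ t := fun h => (ha a (by simp [h])).false
  intro b c hbc hs
  by_cases hba : b = a
  · subst hba
    -- Both outer letters of the pattern lie in the block, so the middle one does too.
    obtain ⟨p, q, he, hp, hq⟩ := List.sublist_append_iff.1 hs
    obtain ⟨p1, p2, rfl, hp1, hp2⟩ := List.sublist_append_iff.1 hp
    have e1 : p1 = [] := by
      rcases p1 with _ | ⟨z, p1⟩
      · rfl
      · obtain rfl : b = z := by simpa using congrArg List.head? he
        exact absurd (hp1.subset (by simp)) has
    have e2 : q = [] := by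
      rcases List.eq_nil_or_concat q with rfl | ⟨q', z, rfl⟩
      · rfl
      · obtain rfl : b = z := by simpa using congrArg List.getLast? he
        exact absurd (hq.subset (by simp)) hat
    subst e1 e2
    have : c ∈ p2 := by
      have : p2 = [b, c, b] := by simpa using he.symm
      simp [this]
    exact hbc.ne' (List.eq_of_mem_replicate (hp2.subset this))
  · have hc : c ≠ a := by
      rintro rfl
      have hb : b ∈ s ++ List.replicate k c ++ t := hs.subset (by simp)
      have : b ∈ s ++ t := by
        simp only [List.mem_append, List.mem_replicate] at hb ⊢
        tauto
      exact (hbc.trans (ha b this)).false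
    have := hs.filter (· ≠ a)
    rw [filter_ne_append_replicate k has hat] at this
    exact h b c hbc (by simpa [hba, hc] using this)

/-- An avoiding word is an avoiding word on `M` with the block inserted at one of `1 + M.card`
positions; as `k ≠ 0`, the position is read off as the index of the first `a`. -/
theorem card_peakAvoidingWord_replicate_add {a : α} {k : ℕ} {M : Multiset α} (hk : k ≠ 0)
    (ha : ∀ x ∈ M, a < x) :
    Nat.card (PeakAvoidingWord (Multiset.replicate k a + M)) =
      (1 + M.card) * Nat.card (PeakAvoidingWord M) := by
  have haM : a ∉ M := fun h => (ha a h).false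
  have hword (l : PeakAvoidingWord M) (i : ℕ) :
      ∀ x ∈ l.1.take i ++ l.1.drop i, a < x := fun x hx =>
    ha x (by rw [← l.2.1]; simpa using hx)
  have has (l : PeakAvoidingWord M) (i : ℕ) : a ∉ l.1.take i := fun h =>
    (hword l i a (List.mem_append_left _ h)).false
  have hat (l : PeakAvoidingWord M) (i : ℕ) : a ∉ l.1.drop i := fun h =>
    (hword l i a (List.mem_append_right _ h)).false
  have hlen (l : PeakAvoidingWord M) : l.1.length = M.card := by
    rw [← Multiset.coe_card, l.2.1]
  let F (p : Fin (1 + M.card) × PeakAvoidingWord M) :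
      PeakAvoidingWord (Multiset.replicate k a + M) :=
    ⟨p.2.1.take p.1 ++ List.replicate k a ++ p.2.1.drop p.1, by
      have h := p.2.2.1
      rw [← List.take_append_drop p.1 p.2.1, ← Multiset.coe_add] at h
      rw [← Multiset.coe_add, ← Multiset.coe_add, Multiset.coe_replicate]
      refine Eq.trans ?_ (congrArg (Multiset.replicate k a + ·) h)
      abel,
      PeakAvoiding.insert_block k (by simpa using p.2.2.2) (hword p.2 p.1)⟩
  have hF : Function.Bijective F := by
    constructor
    · rintro ⟨i, l⟩ ⟨j, l'⟩ h
      have h : l.1.take i ++ List.replicate k a ++ l.1.drop i =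
        l'.1.take j ++ List.replicate k a ++ l'.1.drop j := congrArg Subtype.val h
      have h1 := congrArg (List.filter (· ≠ a)) h
      rw [filter_ne_append_replicate k (has l i) (hat l i),
        filter_ne_append_replicate k (has l' j) (hat l' j), List.take_append_drop,
        List.take_append_drop] at h1
      obtain rfl : l = l' := Subtype.ext h1
      have hidx (i : Fin (1 + M.card)) :
          (l.1.take i ++ List.replicate k a ++ l.1.drop i).idxOf a = i := by
        obtain ⟨k, rfl⟩ := Nat.exists_eq_succ_of_ne_zero hk
        rw [List.append_assoc, List.idxOf_append_of_notMem (has l i), List.replicate_succ,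
          List.cons_append, List.idxOf_cons_self, List.length_take, hlen]
        omega
      have h2 := congrArg (List.idxOf a) h
      rw [hidx, hidx] at h2
      exact Prod.ext (Fin.ext h2) rfl
    · rintro ⟨l, hl, hav⟩
      have hcount : l.count a = k := by
        rw [← Multiset.coe_count, hl]
        simp [Multiset.count_eq_zero_of_notMem haM]
      obtain ⟨s, t, hs, ht, he⟩ := hav.exists_block (a := a) fun x hx => by
        rw [← Multiset.mem_coe, hl, Multiset.mem_add] at hx
        rcases hx with hx | hx
        · exact (Multiset.eq_of_mem_replicate hx).ge
        · exact (ha x hx).le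
      rw [hcount] at he
      have hst : ((s ++ t : List α) : Multiset α) = M := by
        rw [he, ← Multiset.coe_add, ← Multiset.coe_add, Multiset.coe_replicate] at hl
        rw [← Multiset.coe_add]
        refine add_left_cancel (a := Multiset.replicate k a) ?_
        rw [← hl]
        abel
      have hlen' : s.length + t.length = M.card := by rw [← hst]; simp
      refine ⟨⟨⟨s.length, by omega⟩, ⟨s ++ t, hst, ?_⟩⟩, Subtype.ext ?_⟩
      · rw [← filter_ne_append_replicate k hs ht, ← he]
        exact hav.sublist List.filter_sublist
      · simp [F, he]
  rw [← Nat.card_congr (Equiv.ofBijective F hF), Nat.card_prod, Nat.card_fin]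

end Counting

/-! ### Block products and the contents of paths. -/

/-- The product attached to a sequence of block lengths. -/
def blockProduct (w : List ℕ) : ℕ :=
  ∏ i ∈ Finset.Icc 2 w.length, (1 + ∑ j ∈ Finset.Icc i w.length, entry w j)

theorem entry_cons_succ (k : ℕ) (w : List ℕ) {j : ℕ} (hj : 1 ≤ j) :
    entry (k :: w) (j + 1) = entry w j := by
  obtain ⟨j, rfl⟩ := Nat.exists_eq_add_of_le' hj
  simp [entry]

theorem sum_entry_cons (k : ℕ) (w : List ℕ) {i : ℕ} (hi : 1 ≤ i) :
    ∑ j ∈ Finset.Icc (i + 1) (w.length + 1), entry (k :: w) j =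
      ∑ j ∈ Finset.Icc i w.length, entry w j := by
  rw [← Finset.map_add_right_Icc, Finset.sum_map]
  exact Finset.sum_congr rfl fun j hj =>
    entry_cons_succ k w (hi.trans (Finset.mem_Icc.1 hj).1)

theorem sum_entry (w : List ℕ) : ∑ j ∈ Finset.Icc 1 w.length, entry w j = w.sum := by
  induction w with
  | nil => simp
  | cons k w ih =>
    rw [List.length_cons, ← Finset.add_sum_Ioc_eq_sum_Icc (by omega),
      ← Finset.Icc_add_one_left_eq_Ioc, sum_entry_cons k w le_rfl, ih]
    simp [entry]

/-- Indices shift by one, so the product for `k :: w` starts with the full sum of `w`; the size `k`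
of the first block never enters. -/
theorem blockProduct_cons (k : ℕ) (w : List ℕ) :
    blockProduct (k :: w) = (1 + w.sum) * blockProduct w := by
  have h : blockProduct (k :: w) =
      ∏ i ∈ Finset.Icc 1 w.length, (1 + ∑ j ∈ Finset.Icc i w.length, entry w j) := by
    rw [blockProduct, List.length_cons, show 2 = 1 + 1 from rfl, ← Finset.map_add_right_Icc,
      Finset.prod_map]
    refine Finset.prod_congr rfl fun i hi => ?_
    rw [addRightEmbedding_apply, sum_entry_cons k w (Finset.mem_Icc.1 hi).1]
  rw [h]
  rcases w with _ | ⟨x, w⟩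
  · simp [blockProduct]
  · rw [← Finset.mul_prod_Ioc_eq_prod_Icc (by simp), ← Finset.Icc_add_one_left_eq_Ioc, sum_entry]
    rfl

theorem upBlocks_replicate (k : ℕ) :
    upBlocks (List.replicate k DyckStep.U) = if k = 0 then [] else [k] := by
  rw [upBlocks, List.splitOn_eq_singleton (by simp)]
  by_cases h : k = 0 <;> simp [h]

theorem upBlocks_replicate_append (k : ℕ) (C : List DyckStep) :
    upBlocks (List.replicate k DyckStep.U ++ DyckStep.D :: C) =
      if k = 0 then upBlocks C else k :: upBlocks C := by
  rw [upBlocks, List.splitOn_append_cons_self_of_not_mem (by simp)]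
  by_cases h : k = 0 <;> simp [h, upBlocks]

theorem exists_eq_replicate_append (C : List DyckStep) :
    ∃ k, C = List.replicate k DyckStep.U ∨
      ∃ C', C = List.replicate k DyckStep.U ++ DyckStep.D :: C' := by
  induction C with
  | nil => exact ⟨0, Or.inl rfl⟩
  | cons s C ih =>
    cases s with
    | D => exact ⟨0, Or.inr ⟨C, rfl⟩⟩
    | U =>
      obtain ⟨k, rfl | ⟨C', rfl⟩⟩ := ih
      · exact ⟨k + 1, Or.inl rfl⟩
      · exact ⟨k + 1, Or.inr ⟨C', rfl⟩⟩

/-- The multiset in which every up-step of the path contributes `j` plus the number of down-steps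
before it. -/
def pathContent : ℕ → List DyckStep → Multiset ℕ
  | _, [] => 0
  | j, DyckStep.U :: C => j ::ₘ pathContent j C
  | j, DyckStep.D :: C => pathContent (j + 1) C

theorem le_of_mem_pathContent {j x : ℕ} {C : List DyckStep} (h : x ∈ pathContent j C) :
    j ≤ x ∧ x ≤ j + C.count DyckStep.D := by
  induction C generalizing j with
  | nil => simp [pathContent] at h
  | cons s C ih =>
    cases s with
    | U =>
      rw [pathContent, Multiset.mem_cons] at h
      rcases h with rfl | h
      · simp
      · simpa using ih h
    | D =>
      have := ih h
      simp only [List.count_cons_self]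
      omega

theorem card_pathContent (j : ℕ) (C : List DyckStep) :
    (pathContent j C).card = C.count DyckStep.U := by
  induction C generalizing j with
  | nil => rfl
  | cons s C ih => cases s <;> simp [pathContent, ih]

theorem pathContent_replicate_append (j k : ℕ) (C : List DyckStep) :
    pathContent j (List.replicate k DyckStep.U ++ C) =
      Multiset.replicate k j + pathContent j C := by
  induction k with
  | zero => simp
  | succ k ih => simp [List.replicate_succ, pathContent, ih]

theorem sum_upBlocks (C : List DyckStep) : (upBlocks C).sum = C.count DyckStep.U := by
  obtain ⟨N, hN⟩ : ∃ N, C.length = N := ⟨_, rfl⟩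
  induction N using Nat.strong_induction_on generalizing C with
  | _ N ih =>
    obtain ⟨k, rfl | ⟨C, rfl⟩⟩ := exists_eq_replicate_append C
    · rw [upBlocks_replicate]
      split_ifs with h <;> simp [h]
    · have := ih C.length (by simp at hN; omega) C rfl
      rw [upBlocks_replicate_append]
      split_ifs with h <;> simp [h, this]

theorem card_peakAvoidingWord_pathContent (j : ℕ) (C : List DyckStep) :
    Nat.card (PeakAvoidingWord (pathContent j C)) = blockProduct (upBlocks C) := by
  obtain ⟨N, hN⟩ : ∃ N, C.length = N := ⟨_, rfl⟩
  induction N using Nat.strong_induction_on generalizing C j with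
  | _ N ih =>
    obtain ⟨k, rfl | ⟨C, rfl⟩⟩ := exists_eq_replicate_append C
    · have := pathContent_replicate_append j k []
      rw [List.append_nil] at this
      rw [upBlocks_replicate, this, pathContent]
      by_cases hk : k = 0
      · simp [hk, blockProduct, card_peakAvoidingWord_zero]
      · rw [card_peakAvoidingWord_replicate_add hk (by simp), card_peakAvoidingWord_zero, if_neg hk]
        simp [blockProduct]
    · have := ih C.length (by simp at hN; omega) (j + 1) C rfl
      rw [upBlocks_replicate_append, pathContent_replicate_append, pathContent]
      by_cases hk : k = 0
      · simp [hk, this]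
      · rw [if_neg hk, blockProduct_cons, sum_upBlocks, ← card_pathContent (j + 1), ← this]
        exact card_peakAvoidingWord_replicate_add hk fun x hx => (le_of_mem_pathContent hx).1

/-- Trailing down-steps leave no trace in the content, hence the hypothesis `hD`. If the first steps
differ, only one content contains `j`. -/
theorem pathContent_injective {j : ℕ} {C C' : List DyckStep}
    (hD : C.count DyckStep.D = C'.count DyckStep.D) (h : pathContent j C = pathContent j C') :
    C = C' := by
  have aux {j : ℕ} {C : List DyckStep} {M : Multiset ℕ} (h : j ::ₘ M = pathContent (j + 1) C) :
      False := by
    have := (le_of_mem_pathContent (h ▸ Multiset.mem_cons_self j M)).1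
    omega
  induction C generalizing j C' with
  | nil =>
    rcases C' with _ | ⟨_ | _, C'⟩
    · rfl
    · simp [pathContent] at h
    · simp at hD
  | cons s C ih =>
    rcases s with _ | _ <;> rcases C' with _ | ⟨_ | _, C'⟩
    · simp [pathContent] at h
    · rw [ih (j := j) (by simpa using hD) (by simpa [pathContent] using h)]
    · exact (aux h).elim
    · simp at hD
    · exact (aux h.symm).elim
    · rw [ih (j := j + 1) (by simpa using hD) (by simpa [pathContent] using h)]

theorem exists_pathContent_eq {j N : ℕ} {M : Multiset ℕ} (h : ∀ x ∈ M, j ≤ x ∧ x ≤ j + N) :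
    ∃ C : List DyckStep, C.count DyckStep.D = N ∧ pathContent j C = M := by
  induction N generalizing j M with
  | zero =>
    refine ⟨List.replicate M.card DyckStep.U, by simp [List.count_replicate], ?_⟩
    have := pathContent_replicate_append j M.card []
    rw [List.append_nil] at this
    rw [this, pathContent, add_zero]
    exact (Multiset.eq_replicate_card.2 fun x hx => by have := h x hx; omega).symm
  | succ N ih =>
    obtain ⟨C, hC, hM⟩ := ih (j := j + 1) (M := M.filter (¬ j = ·)) fun x hx => by
      rw [Multiset.mem_filter] at hx
      have := h x hx.1
      omega
    refine ⟨List.replicate (M.count j) DyckStep.U ++ DyckStep.D :: C, by simp [hC, List.count_replicate], ?_⟩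
    rw [pathContent_replicate_append, pathContent, hM, ← Multiset.filter_eq,
      Multiset.filter_add_not]

/-- The inequality is tightest at the start and just after each down-step. The up-steps before the
`e`-th down-step are those labelled below `j + e`; `d` and `u` account for steps already read. -/
theorem path_nonneg_iff {m : ℕ} (j d u : ℕ) (C : List DyckStep) :
    (∀ k, d + (C.take k).count DyckStep.D ≤ m * (u + (C.take k).count DyckStep.U)) ↔
      ∀ e ≤ C.count DyckStep.D, d + e ≤ m * (u + ((pathContent j C).filter (· < j + e)).card) := by
  have zero (j : ℕ) (C : List DyckStep) : (pathContent j C).filter (· < j) = 0 :=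
    Multiset.filter_eq_nil.2 fun x hx => not_lt.2 (le_of_mem_pathContent hx).1
  have cons (d u : ℕ) (s : DyckStep) (C : List DyckStep) :
      (∀ k, d + ((s :: C).take k).count DyckStep.D ≤
        m * (u + ((s :: C).take k).count DyckStep.U)) ↔ d ≤ m * u ∧
      ∀ k, d + (s :: C.take k).count DyckStep.D ≤ m * (u + (s :: C.take k).count DyckStep.U) := by
    refine ⟨fun h => ⟨by simpa using h 0, fun k => h (k + 1)⟩, fun h k => ?_⟩
    cases k with
    | zero => simpa using h.1
    | succ k => exact h.2 k
  induction C generalizing j d u with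
  | nil => simp [pathContent]
  | cons s C ih =>
    rw [cons]
    cases s with
    | U =>
      simp only [List.count_cons_self, ne_eq, reduceCtorEq, not_false_eq_true,
        List.count_cons_of_ne, pathContent]
      have := ih j d (u + 1)
      have shift (x : ℕ) : u + 1 + x = u + (x + 1) := by omega
      simp only [shift] at this
      refine (and_congr_right fun _ => this).trans ?_
      constructor
      · rintro ⟨h0, h⟩ e he
        rcases Nat.eq_zero_or_pos e with rfl | hpos
        · rw [add_zero]
          exact h0.trans (Nat.mul_le_mul_left _ (Nat.le_add_right _ _))
        · rw [Multiset.filter_cons_of_pos _ (by omega), Multiset.card_cons]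
          exact h e he
      · intro h
        have h0 : d ≤ m * u := by
          have := h 0 (Nat.zero_le _)
          rw [add_zero, add_zero, Multiset.filter_cons_of_neg _ (by simp), zero] at this
          simpa using this
        refine ⟨h0, fun e he => ?_⟩
        rcases Nat.eq_zero_or_pos e with rfl | hpos
        · rw [add_zero]
          exact h0.trans (Nat.mul_le_mul_left _ (by omega))
        · have := h e he
          rwa [Multiset.filter_cons_of_pos _ (by omega), Multiset.card_cons] at this
    | D =>
      simp only [List.count_cons_self, ne_eq, reduceCtorEq, not_false_eq_true,
        List.count_cons_of_ne, pathContent]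
      have := ih (j + 1) (d + 1) u
      have shift (x : ℕ) : d + 1 + x = d + (x + 1) := by omega
      simp only [shift] at this
      refine (and_congr_right fun _ => this).trans ?_
      constructor
      · rintro ⟨h0, h⟩ e he
        rcases e with _ | e
        · exact h0.trans (Nat.mul_le_mul_left _ (Nat.le_add_right _ _))
        · have := h e (by omega)
          rwa [show j + 1 + e = j + (e + 1) by omega] at this
      · intro h
        refine ⟨?_, fun e he => ?_⟩
        · have := h 0 (Nat.zero_le _)
          rw [add_zero, add_zero, Multiset.filter_eq_nil.2 fun x hx =>
            not_lt.2 (Nat.le_of_succ_le (le_of_mem_pathContent hx).1)] at this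
          simpa using this
        · have := h (e + 1) (by omega)
          rwa [show j + (e + 1) = j + 1 + e by omega] at this

/-! ### Parking contents and Catalan paths. -/

/-- The contents of `m`-parking functions of size `n`. -/
def IsMParkingContent (m n : ℕ) (M : Multiset ℕ) : Prop :=
  M.card = n ∧ (∀ x ∈ M, 1 ≤ x) ∧ ∀ i < n, i < (M.filter (· ≤ 1 + m * i)).card

theorem IsMParkingContent.le {m n x : ℕ} {M : Multiset ℕ} (h : IsMParkingContent m n M)
    (hx : x ∈ M) : x ≤ 1 + m * (n - 1) := by
  have hn : 0 < n := h.1 ▸ Multiset.card_pos_iff_exists_mem.2 ⟨x, hx⟩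
  have h1 := h.2.2 (n - 1) (by omega)
  have h2 : M.filter (· ≤ 1 + m * (n - 1)) = M :=
    Multiset.eq_of_le_of_card_le (Multiset.filter_le _ _) (by rw [h.1]; omega)
  exact Multiset.filter_eq_self.1 h2 x hx

/-- An entry of the sorted sequence at position `i`, counted from `0`, is at most a bound exactly
when more than `i` values are. -/
theorem isMParkingFunction_iff {m n : ℕ} (f : Fin n → ℕ) :
    IsMParkingFunction m n f ↔ IsMParkingContent m n (List.ofFn f : Multiset ℕ) := by
  have hmem (P : ℕ → Prop) : (∀ x ∈ (List.ofFn f : Multiset ℕ), P x) ↔ ∀ i, P (f i) := by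
    simp [List.mem_ofFn]
  have hsort (i : Fin n) : f (Tuple.sort f i) ≤ 1 + m * (i : ℕ) ↔
      (i : ℕ) < ((List.ofFn f : Multiset ℕ).filter (· ≤ 1 + m * (i : ℕ))).card := by
    have h := Tuple.lt_card_le_iff_apply_le_of_monotone (j := i) (a := 1 + m * (i : ℕ))
      (Tuple.monotone_sort f)
    have hcard : (Finset.univ.filter fun k => (f ∘ Tuple.sort f) k ≤ 1 + m * (i : ℕ)).card =
        ((List.ofFn f : Multiset ℕ).filter (· ≤ 1 + m * (i : ℕ))).card := by
      rw [← Fin.univ_val_map, Multiset.filter_map, Multiset.card_map,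
        ← Finset.card_map (Tuple.sort f).toEmbedding]
      change _ = (Finset.univ.filter _).card
      congr 1
      ext k
      simp
    rw [hcard] at h
    exact h.symm
  constructor
  · intro h
    refine ⟨by simp, (hmem _).2 fun i => (Finset.mem_Icc.1 (h.1 i)).1, fun i hi => ?_⟩
    exact (hsort ⟨i, hi⟩).1 (h.2 ⟨i, hi⟩)
  · intro h
    refine ⟨fun i => Finset.mem_Icc.2 ⟨(hmem _).1 h.2.1 i, (hmem _).1 (fun x hx => h.le hx) i⟩,
      fun i => (hsort i).2 (h.2.2 i i.2)⟩

theorem isMCatalanPath_iff {m n : ℕ} (hm : 1 ≤ m) (C : List DyckStep) :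
    IsMCatalanPath m n C ↔
      C.count DyckStep.D = m * n ∧ IsMParkingContent m n (pathContent 1 C) := by
  have h := path_nonneg_iff (m := m) 1 0 0 C
  simp only [zero_add, Nat.add_comm 1, Nat.lt_succ_iff] at h
  rw [IsMCatalanPath, h, IsMParkingContent, card_pathContent]
  constructor
  · rintro ⟨h1, h2, h3⟩
    refine ⟨h2, h1, fun x hx => (le_of_mem_pathContent hx).1, fun i hi => ?_⟩
    -- Just after down-step `1 + m * i`, height at least `0` forces more than `i` up-steps.
    have := h3 (1 + m * i) (by rw [h2]; nlinarith)
    exact lt_of_mul_lt_mul_left (by omega) (Nat.zero_le m)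
  · rintro ⟨h2, h1, -, h3⟩
    refine ⟨h1, h2, fun e he => ?_⟩
    rcases e with _ | e
    · exact Nat.zero_le _
    rw [h2] at he
    -- Conversely, down-step `e + 1` is controlled by the parking condition at `i = e / m`, since `e
    -- + 1 ≤ m * (e / m + 1)`.
    have hi : e / m < n := Nat.div_lt_of_lt_mul (by omega)
    have hle : 1 + m * (e / m) ≤ e + 1 := by have := Nat.mul_div_le e m; omega
    have h4 := (h3 _ hi).trans_le (Multiset.card_le_card
      (Multiset.monotone_filter_right _ (q := (· ≤ e + 1)) fun x hx => le_trans hx hle))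
    have h5 : e < m * (e / m + 1) := Nat.lt_mul_div_succ e hm
    exact h5.trans_le (Nat.mul_le_mul_left _ h4)

/-- Every metasylvester class of parking functions has exactly one member avoiding `b c b`. -/
theorem card_quotient_mParkingSetoid (m n : ℕ) :
    Nat.card (Quotient (mParkingSetoid m n)) =
      Nat.card {l : List ℕ // IsMParkingContent m n l ∧ PeakAvoiding l} := by
  have hof {l : List ℕ} (h : IsMParkingContent m n l) :
      ∃ f : MParkingFunction m n, f.word = l := by
    obtain rfl : l.length = n := h.1
    have : List.ofFn l.get = l := List.ofFn_get l
    exact ⟨⟨l.get, (isMParkingFunction_iff _).2 (by rwa [this])⟩, this⟩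
  choose g hg using @hof
  let F (l : {l : List ℕ // IsMParkingContent m n l ∧ PeakAvoiding l}) :
      Quotient (mParkingSetoid m n) := Quotient.mk _ (g l.2.1)
  refine (Nat.card_congr (Equiv.ofBijective F ⟨fun l l' h => ?_, fun q => ?_⟩)).symm
  · have h : metasylvesterSetoid ℕ (g l.2.1).word (g l'.2.1).word :=
      Quotient.exact (s := mParkingSetoid m n) h
    rw [hg, hg] at h
    exact Subtype.ext (l.2.2.eq_of_equiv l'.2.2 h)
  · induction q using Quotient.inductionOn with
    | _ f =>
      obtain ⟨l, hl, hav⟩ := exists_peakAvoiding_equiv f.word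
      have hc : IsMParkingContent m n l := by
        rw [← Multiset.coe_eq_coe.2 (metasylvester_perm hl)]
        exact (isMParkingFunction_iff _).1 f.2
      refine ⟨⟨l, hc, hav⟩, Quotient.sound ?_⟩
      change metasylvesterSetoid ℕ (g hc).word f.word
      rw [hg]
      exact (metasylvesterSetoid ℕ).symm hl

theorem mem_mCatalanPaths {m n : ℕ} {C : List DyckStep} :
    C ∈ mCatalanPaths m n ↔ IsMCatalanPath m n C := by
  simp [mCatalanPaths]

theorem mainTheorem12 (m n : ℕ) (hm : 1 ≤ m) :
    Nat.card (Quotient (mParkingSetoid m n)) =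
      ∑ C ∈ mCatalanPaths m n,
        ∏ i ∈ Finset.Icc 2 (upBlocks C).length,
          (1 + ∑ j ∈ Finset.Icc i (upBlocks C).length, entry (upBlocks C) j) := by
  have hpath (C : mCatalanPaths m n) := (isMCatalanPath_iff hm C.1).1 (mem_mCatalanPaths.1 C.2)
  let F (p : Σ C : mCatalanPaths m n, PeakAvoidingWord (pathContent 1 C.1)) :
      {l : List ℕ // IsMParkingContent m n l ∧ PeakAvoiding l} :=
    ⟨p.2.1, by rw [p.2.2.1]; exact (hpath p.1).2, p.2.2.2⟩
  have hF : Function.Bijective F := by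
    constructor
    · rintro ⟨C, l, hl⟩ ⟨C', l', hl'⟩ h
      obtain rfl : l = l' := congrArg Subtype.val h
      obtain rfl : C = C' := Subtype.ext (pathContent_injective
        ((hpath C).1.trans (hpath C').1.symm) (hl.1.symm.trans hl'.1))
      rfl
    · rintro ⟨l, hl, hav⟩
      -- Letters are at most `1 + m * (n - 1)`, so `m * n` down-steps suffice to realise the
      -- content.
      obtain ⟨C, hD, hC⟩ := exists_pathContent_eq (j := 1) (N := m * n) (M := (l : Multiset ℕ))
        fun x hx => ⟨hl.2.1 x hx,
          (hl.le hx).trans (Nat.add_le_add_left (Nat.mul_le_mul_left _ (Nat.sub_le _ _)) _)⟩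
      exact ⟨⟨⟨C, mem_mCatalanPaths.2 ((isMCatalanPath_iff hm C).2 ⟨hD, hC ▸ hl⟩)⟩,
        ⟨l, hC.symm, hav⟩⟩, rfl⟩
  rw [card_quotient_mParkingSetoid, ← Nat.card_congr (Equiv.ofBijective F hF), Nat.card_sigma]
  refine Eq.trans ?_ (Finset.sum_coe_sort (mCatalanPaths m n) fun C => blockProduct (upBlocks C))
  exact Finset.sum_congr rfl fun C _ => card_peakAvoidingWord_pathContent 1 C.1
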